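/- **Conventions.** An $r$-uniform hypergraph $H=(V,E)$ has a finite vertex set $V$ and a set $E$ of $r$-element subsets of $V$; a set $I\subseteq V$ is independent if it contains no edge. For $r\ge 2$, the link of $x$ in $H$ is the $(r-1)$-uniform hypergraph $H_x$ with vertex set $V_x=\{y\in V\setminus\{x\}: \text{some } e\in E \text{ contains } x \text{ and } y\}$, in which an $(r-1)$-subset $e$ of $V_x$ is an edge if and only if $e\cup\{x\}\in E$. The theta body $\mathrm{TH}(H)\subseteq\mathbb{R}^V$ is defined recursively. For $r=1$ it is the convex hull of the characteristic functions of the independent sets of $H$. For $r\ge2$ it is the set of all $f\in\mathbb{R}^V$ for which there is $F\in\mathbb{R}^{V\times V}$ with $f=\operatorname{diag}F$, with $(F(x,y))_{y\in V_x}\in F(x,x)\,\mathrm{TH}(H_x)$ for every $x\in V$ with $V_x\neq\emptyset$, and with $\begin{pmatrix}1&f^{\mathsf T}\\ f&F\end{pmatrix}$ (symmetric) positive semidefinite. (For $r=2$ this is the usual Lovász theta body of a graph.) The theta number of $H$ is $\vartheta(H)=\max\{\sum_{x\in V}f(x): f\in\mathrm{TH}(H)\}$. Let $\mathbb{H}^n=\{0,1\}^n$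 with the Hamming distance $d$, let $\mathbb{H}^n_s$ be the set of words of weight $s$ (words with exactly $s$ ones), and let $H(n,s)$ be the $3$-uniform hypergraph with vertex set $\mathbb{H}^n$ whose edges are the sets of three distinct points at pairwise distance $s$. For integers $0\le s\le n$ and $0\le k,t\le\min\{s,n-s\}$ let $$Q^{n,s}_k(t)=\sum_{i=0}^k(-1)^i\binom{s}{i}^{-1}\binom{n-s}{i}^{-1}\binom{k}{i}\binom{n+1-k}{i}\binom{t}{i}$$ be the Hahn polynomial of degree $k$ normalized so that $Q^{n,s}_k(0)=1$. **Theorem.** Let $n\ge1$ be an integer and let $s$ be an even integer with $0<s\le\lfloor 2n/3\rfloor$. Then the link $H(n,s)_0$ of the zero word is the graph with vertex set $\mathbb{H}^n_s$ in which two words are adjacent if and only if they are at distance $s$; the maximum defining its theta number is attained; and $$\vartheta(H(n,s)_0)=|\mathbb{H}^n_s|\,\frac{M^n_Q(s)}{M^n_Q(s)-1},\qquad\text{where } M^n_Q(s)=\min\{\,Q^{n,s}_k(s/2): k=0,\dots,\min\{s,n-s\}\,\}.$$ -/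

import Mathlib

open scoped Pointwise

noncomputable section

/-- An `r`-uniform hypergraph: every edge has exactly `r` elements. -/
structure UniformHypergraph (α : Type*) (r : ℕ) extends Hypergraph α where
  /-- Every edge has exactly `r` elements. -/
  encard_edge : ∀ e ∈ edgeSet, e.encard = r

namespace UniformHypergraph

variable {α : Type*} {r : ℕ}

/-- The link of `x`: its vertices are the `y ≠ x` that lie in a common edge with `x`, and an
`r`-subset `e` of them is an edge if and only if `e ∪ {x}` is an edge of `H`. -/
def link (H : UniformHypergraph α (r + 1)) (x : α) : UniformHypergraph α r where
  vertexSet := {y | y ≠ x ∧ ∃ e ∈ H.edgeSet, x ∈ e ∧ y ∈ e}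
  edgeSet := {e | e ⊆ {y | y ≠ x ∧ ∃ e ∈ H.edgeSet, x ∈ e ∧ y ∈ e} ∧ e.encard = r ∧
    insert x e ∈ H.edgeSet}
  subset_vertexSet_of_mem_edgeSet' := fun _ he => he.1
  encard_edge := fun _ he => he.2.1

theorem link_vertexSet_subset (H : UniformHypergraph α (r + 1)) (x : α) :
    (H.link x).vertexSet ⊆ H.vertexSet := by
  rintro y ⟨-, e, he, -, hy⟩
  exact H.subset_vertexSet_of_mem_edgeSet' he hy

/-- A set of vertices is independent if it contains no edge. -/
def IsIndependent (H : UniformHypergraph α r) (I : Set α) : Prop :=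
  I ⊆ H.vertexSet ∧ ∀ e ∈ H.edgeSet, ¬ e ⊆ I

/-- The independent-set polytope: the convex hull of the characteristic functions of the
independent sets. -/
def independentSetPolytope (H : UniformHypergraph α r) : Set (H.vertexSet → ℝ) :=
  convexHull ℝ {f : H.vertexSet → ℝ | ∃ I : Set α, H.IsIndependent I ∧ f = fun x : H.vertexSet => I.indicator (fun _ => (1 : ℝ)) (x : α)}

end UniformHypergraph

/-- The bordered matrix `[1, aᵀ; a, A]`, where `a` is the diagonal of `A`. -/
def borderedMatrix {ι : Type*} (A : Matrix ι ι ℝ) : Matrix (Unit ⊕ ι) (Unit ⊕ ι) ℝ :=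
  Matrix.fromBlocks 1 (Matrix.of fun _ y => A y y) (Matrix.of fun x _ => A x x) A

namespace UniformHypergraph

/-- The theta body of an `r`-uniform hypergraph on finitely many vertices, `r ≥ 1`, by recursion
on `r`. (For `r = 0`, where the notion is not used, we also put the independent-set polytope.) -/
def thetaBody {α : Type*} : (r : ℕ) → (H : UniformHypergraph α r) → Set (H.vertexSet → ℝ)
  | 0, H => H.independentSetPolytope
  | 1, H => H.independentSetPolytope
  | r + 2, H => {f | ∃ F : Matrix H.vertexSet H.vertexSet ℝ,
      f = F.diag ∧
      (∀ x : H.vertexSet, (H.link x).vertexSet.Nonempty →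
        (fun y : (H.link x).vertexSet => F x ⟨y, H.link_vertexSet_subset x y.2⟩) ∈
          F x x • thetaBody (r + 1) (H.link x)) ∧
      (borderedMatrix F).PosSemidef}

/-- The values `wᵀ f` for `f` in the theta body of `H`. -/
def thetaValues {α : Type*} {r : ℕ} (H : UniformHypergraph α r) (w : H.vertexSet → ℝ) : Set ℝ :=
  {v | ∃ f ∈ thetaBody r H, v = ∑ᶠ x, w x * f x}

/-- The theta number of `H` for the weight function `w`. -/
def weightedThetaNumber {α : Type*} {r : ℕ} (H : UniformHypergraph α r)
    (w : H.vertexSet → ℝ) : ℝ :=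
  sSup (H.thetaValues w)

/-- The theta number of `H` (unit weights). -/
def thetaNumber {α : Type*} {r : ℕ} (H : UniformHypergraph α r) : ℝ :=
  H.weightedThetaNumber 1

end UniformHypergraph

/-- The Hamming cube `{0,1}ⁿ`; distance and weight are `hammingDist` and `hammingNorm`. -/
abbrev HammingCube (n : ℕ) : Type := Fin n → Fin 2

/-- The set of words of weight `s`. -/
def weightWords (n s : ℕ) : Set (HammingCube n) := {x | hammingNorm x = s}

/-- The 3-uniform hypergraph on the Hamming cube whose edges are the `s`-triangles: the sets of
three distinct points at pairwise distance `s`. -/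
def triangleHypergraph (n s : ℕ) : UniformHypergraph (HammingCube n) 3 where
  vertexSet := Set.univ
  edgeSet := {e | e.encard = 3 ∧ ∀ x ∈ e, ∀ y ∈ e, x ≠ y → hammingDist x y = s}
  subset_vertexSet_of_mem_edgeSet' := fun _ _ => Set.subset_univ _
  encard_edge := fun _ he => he.1

/-- The Hahn polynomial of degree `k` for the words of length `n` and weight `s`, normalized to
be `1` at `0`, evaluated at an integer `t`. It is used for `k ≤ min s (n - s)` only; then all
the subtractions are exact and all the inverted binomial coefficients are positive. -/
def hahnQ (n s k t : ℕ) : ℝ :=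
  ∑ i ∈ Finset.range (k + 1),
    (-1 : ℝ) ^ i * ((s.choose i : ℝ))⁻¹ * (((n - s).choose i : ℝ))⁻¹ *
      (k.choose i : ℝ) * ((n + 1 - k).choose i : ℝ) * (t.choose i : ℝ)

/-- The minimum of the values at `s / 2` of the Hahn polynomials, over all degrees `k` for which
they exist, that is, `0 ≤ k ≤ min s (n - s)`. -/
def hahnMin (n s : ℕ) : ℝ :=
  (Finset.range (min s (n - s) + 1)).inf' Finset.nonempty_range_add_one
    fun k => hahnQ n s k (s / 2)

end

noncomputable section

/-! In the link of the zero word, adjacency means excess `s / 2`. Each vertex of the link of a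
vertex in this graph is an edge there, so that theta body is `{0}`. With a Schur complement, the
theta body becomes the set of diagonals `f` of matrices `F` that vanish on edges and satisfy `F - f
fᵀ ⪰ 0`.

The matrices `E_k = zonal n s (hahnQ n s k)` are common eigenmatrices of the Johnson scheme. No
representation theory is needed: the sum of all transpositions acts on functions of the excess as a
second-order difference operator, the Hahn polynomials are eigenfunctions with distinct eigenvalues,
and a solution is fixed by its value at `0`. Hence `E_k` is positive semidefinite, `1 = ∑ c_k E_k`
with `c_k ≥ 0`, and the adjacency matrix multiplies `E_k` by the degree times `Q_k(s/2)`
(`zonal_indicator_mul_hahn`).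

Upper bound (`trace_le_of_feasible`): put `a_k = c_k tr(F E_k) ≥ 0`, `N` the number of words and `M`
the minimum. Then `∑ a_k = tr F`, `∑ a_k Q_k(s/2) = 0` and `N a_0 ≥ (tr F)²`, which gives `tr F ≤ N
M / (M - 1)`. Equality (`exists_feasible`) holds for `F = c² (J - E_k / M)`, with `J` the all-ones
matrix, `k` a minimizing degree and `c = M / (M - 1)`. -/

open Finset in
/-- The number of positions at which the pair of words `(x, y)` takes the value `c`. -/
def profileCount {n : ℕ} (x y : HammingCube n) (c : Fin 2 × Fin 2) : ℕ := #{i | (x i, y i) = c}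

/-- The number of positions at which `x` is `1` and `y` is `0`. -/
def excess {n : ℕ} (x y : HammingCube n) : ℕ := profileCount x y (1, 0)

/-! ### Profiles of pairs of words under permutations of the positions. -/

section Counting

variable {n : ℕ} {x y : HammingCube n}

theorem profileCount_eq_sum (x y : HammingCube n) (c : Fin 2 × Fin 2) :
    profileCount x y c = ∑ i, if (x i, y i) = c then 1 else 0 := by
  rw [profileCount, Finset.card_filter]

theorem hammingNorm_eq_left (x y : HammingCube n) :
    profileCount x y (1, 0) + profileCount x y (1, 1) = hammingNorm x := by
  simp only [profileCount_eq_sum, hammingNorm, Finset.card_filter, ← Finset.sum_add_distrib]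
  refine Finset.sum_congr rfl fun i _ => ?_
  generalize x i = a
  generalize y i = b
  fin_cases a <;> fin_cases b <;> simp

theorem hammingNorm_eq_right (x y : HammingCube n) :
    profileCount x y (0, 1) + profileCount x y (1, 1) = hammingNorm y := by
  simp only [profileCount_eq_sum, hammingNorm, Finset.card_filter, ← Finset.sum_add_distrib]
  refine Finset.sum_congr rfl fun i _ => ?_
  generalize x i = a
  generalize y i = b
  fin_cases a <;> fin_cases b <;> simp

theorem hammingDist_eq_profileCount (x y : HammingCube n) :
    hammingDist x y = profileCount x y (1, 0) + profileCount x y (0, 1) := by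
  simp only [profileCount_eq_sum, hammingDist, Finset.card_filter, ← Finset.sum_add_distrib]
  refine Finset.sum_congr rfl fun i _ => ?_
  generalize x i = a
  generalize y i = b
  fin_cases a <;> fin_cases b <;> simp

theorem sum_profileCount (x y : HammingCube n) :
    profileCount x y (0, 0) + profileCount x y (0, 1) + profileCount x y (1, 0) +
      profileCount x y (1, 1) = n := by
  have h : ∑ i : Fin n, 1 = n := by simp
  conv_rhs => rw [← h]
  simp only [profileCount_eq_sum, ← Finset.sum_add_distrib]
  refine Finset.sum_congr rfl fun i _ => ?_
  generalize x i = a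
  generalize y i = b
  fin_cases a <;> fin_cases b <;> simp

theorem profileCount_comp_perm (σ : Equiv.Perm (Fin n)) (x y : HammingCube n)
    (c : Fin 2 × Fin 2) : profileCount (x ∘ σ) (y ∘ σ) c = profileCount x y c := by
  simp only [profileCount_eq_sum, Function.comp_apply]
  exact Equiv.sum_comp σ fun i => if (x i, y i) = c then 1 else 0

theorem excess_comp_perm (σ : Equiv.Perm (Fin n)) (x y : HammingCube n) :
    excess (x ∘ σ) (y ∘ σ) = excess x y :=
  profileCount_comp_perm σ x y _

theorem hammingNorm_comp_perm (σ : Equiv.Perm (Fin n)) (x : HammingCube n) :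
    hammingNorm (x ∘ σ) = hammingNorm x := by
  rw [← hammingNorm_eq_left (x ∘ σ) (x ∘ σ), ← hammingNorm_eq_left x x,
    profileCount_comp_perm, profileCount_comp_perm]

/-- The fibers of the two profile maps have equal sizes; bijections between them glue to a
permutation. -/
theorem exists_perm_of_profileCount_eq {x y x' y' : HammingCube n}
    (h : ∀ c, profileCount x y c = profileCount x' y' c) :
    ∃ σ : Equiv.Perm (Fin n), x ∘ σ = x' ∧ y ∘ σ = y' := by
  have e : ∀ c, Nonempty ({i // (x' i, y' i) = c} ≃ {i // (x i, y i) = c}) := fun c => by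
    refine ⟨Fintype.equivOfCardEq ?_⟩
    rw [Fintype.card_subtype, Fintype.card_subtype]
    exact (h c).symm
  let σ : Equiv.Perm (Fin n) :=
    (Equiv.sigmaFiberEquiv fun i => (x' i, y' i)).symm.trans
      ((Equiv.sigmaCongrRight fun c => (e c).some).trans
        (Equiv.sigmaFiberEquiv fun i => (x i, y i)))
  have hσ : ∀ i, (x (σ i), y (σ i)) = (x' i, y' i) := fun i =>
    ((e (x' i, y' i)).some ⟨i, rfl⟩).2
  exact ⟨σ, funext fun i => congrArg Prod.fst (hσ i), funext fun i => congrArg Prod.snd (hσ i)⟩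

end Counting

/-! ### Pairs of words of equal weight: the excess is a complete invariant. -/

section ConstantWeight

variable {n s : ℕ} {x y x' y' : HammingCube n}

theorem profileCount_of_mem (hx : x ∈ weightWords n s) (hy : y ∈ weightWords n s) :
    profileCount x y (1, 0) = excess x y ∧ profileCount x y (0, 1) = excess x y ∧
      profileCount x y (1, 1) + excess x y = s ∧
      profileCount x y (0, 0) + s + excess x y = n := by
  have h1 := hammingNorm_eq_left x y
  have h2 := hammingNorm_eq_right x y
  have h3 := sum_profileCount x y
  simp only [weightWords, Set.mem_ofPred_eq] at hx hy
  unfold excess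
  omega

theorem hammingDist_eq_two_mul_excess (hx : x ∈ weightWords n s) (hy : y ∈ weightWords n s) :
    hammingDist x y = 2 * excess x y := by
  have := profileCount_of_mem hx hy
  rw [hammingDist_eq_profileCount]
  omega

theorem excess_comm (hx : x ∈ weightWords n s) (hy : y ∈ weightWords n s) :
    excess x y = excess y x := by
  have h1 := hammingDist_eq_two_mul_excess hx hy
  have h2 := hammingDist_eq_two_mul_excess hy hx
  rw [hammingDist_comm] at h1
  omega

theorem excess_le (hx : x ∈ weightWords n s) (hy : y ∈ weightWords n s) :
    excess x y ≤ min s (n - s) := by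
  have := profileCount_of_mem hx hy
  omega

theorem excess_eq_zero_iff (hx : x ∈ weightWords n s) (hy : y ∈ weightWords n s) :
    excess x y = 0 ↔ x = y := by
  have := hammingDist_eq_two_mul_excess hx hy
  rw [← hammingDist_eq_zero]
  omega

/-- At fixed weight the excess determines all four profile counts, so its level sets are the orbits
on pairs. -/
theorem exists_perm_of_excess_eq (hx : x ∈ weightWords n s) (hy : y ∈ weightWords n s)
    (hx' : x' ∈ weightWords n s) (hy' : y' ∈ weightWords n s) (h : excess x y = excess x' y') :
    ∃ σ : Equiv.Perm (Fin n), x ∘ σ = x' ∧ y ∘ σ = y' := by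
  apply exists_perm_of_profileCount_eq
  have h1 := profileCount_of_mem hx hy
  have h2 := profileCount_of_mem hx' hy'
  rintro ⟨a, b⟩
  fin_cases a <;> fin_cases b <;> simp only [Fin.zero_eta, Fin.mk_one] <;> omega

theorem exists_excess_eq (hx : x ∈ weightWords n s) {t : ℕ} (ht : t ≤ min s (n - s)) :
    ∃ y ∈ weightWords n s, excess x y = t := by
  classical
  have h0 := profileCount_of_mem hx hx
  have hxx : excess x x = 0 := (excess_eq_zero_iff hx hx).2 rfl
  obtain ⟨U, hU, hUc⟩ := Finset.exists_subset_card_eq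
    (s := Finset.univ.filter fun i => (x i, x i) = (1, 1)) (n := t)
    (by change t ≤ profileCount x x (1, 1); omega)
  obtain ⟨W, hW, hWc⟩ := Finset.exists_subset_card_eq
    (s := Finset.univ.filter fun i => (x i, x i) = (0, 0)) (n := t)
    (by change t ≤ profileCount x x (0, 0); omega)
  have hU' : ∀ i ∈ U, x i = 1 := fun i hi => by simpa using hU hi
  have hW' : ∀ i ∈ W, x i = 0 := fun i hi => by simpa using hW hi
  -- Erase `t` ones of `x` (on `U`) and fill `t` zeros (on `W`).
  let y : HammingCube n := fun i => if i ∈ U then 0 else if i ∈ W then 1 else x i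
  have h10 : profileCount x y (1, 0) = t := by
    rw [← hUc, profileCount]
    congr 1
    ext i
    by_cases h1 : i ∈ U
    · simp [y, h1, hU' i h1]
    · by_cases h2 : i ∈ W
      · simp [y, h1, h2]
      · simp only [y, h1, h2, if_false, Finset.mem_filter, Finset.mem_univ, true_and, iff_false]
        generalize x i = a
        revert a; decide
  have h01 : profileCount x y (0, 1) = t := by
    rw [← hWc, profileCount]
    congr 1
    ext i
    by_cases h1 : i ∈ U
    · have : i ∉ W := fun h => by simpa [hU' i h1] using hW' i h
      simp [y, h1, this]
    · by_cases h2 : i ∈ W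
      · simp [y, h1, h2, hW' i h2]
      · simp only [y, h1, h2, if_false, Finset.mem_filter, Finset.mem_univ, true_and, iff_false]
        generalize x i = a
        revert a; decide
  refine ⟨y, ?_, h10⟩
  have h1 := hammingNorm_eq_left x y
  have h2 := hammingNorm_eq_right x y
  simp only [weightWords, Set.mem_ofPred_eq] at hx ⊢
  omega

theorem weightWords_nonempty (h : s ≤ n) : (weightWords n s).Nonempty := by
  obtain ⟨U, -, hU⟩ := Finset.exists_subset_card_eq (s := (Finset.univ : Finset (Fin n)))
    (n := s) (by simpa using h)
  refine ⟨fun i => if i ∈ U then 1 else 0, ?_⟩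
  simp [weightWords, hammingNorm, hU]

end ConstantWeight

/-! ### The effect of transpositions on the excess. -/

section Transpositions

variable {n : ℕ} {x y : HammingCube n} {i j : Fin n}

theorem comp_swap_of_eq (h : x i = x j) : x ∘ Equiv.swap i j = x := by
  funext l
  simp only [Function.comp_apply, Equiv.swap_apply_def]
  split_ifs with h1 h2
  · rw [h1, h]
  · rw [h2, h]
  · rfl

/-- The additive form avoids truncated subtraction and can be checked position by position. -/
theorem excess_comp_swap (hi : x i = 1) (hj : x j = 0) :
    excess (x ∘ Equiv.swap i j) y + (if y i = 0 then 1 else 0) =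
      excess x y + if y j = 0 then 1 else 0 := by
  have hij : i ≠ j := by rintro rfl; simp [hi] at hj
  have e1 : (if y i = 0 then 1 else 0) =
      ∑ l, if l = i then (if y i = 0 then 1 else 0) else 0 := by simp
  have e2 : (if y j = 0 then 1 else 0) =
      ∑ l, if l = j then (if y j = 0 then 1 else 0) else 0 := by simp
  rw [e1, e2]
  simp only [excess, profileCount_eq_sum, ← Finset.sum_add_distrib]
  refine Finset.sum_congr rfl fun l _ => ?_
  by_cases h1 : l = i
  · subst h1
    simp [hi, hj, hij]
  · by_cases h2 : l = j
    · subst h2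
      simp [hi, hj, h1]
    · simp [h1, h2, Equiv.swap_apply_of_ne_of_ne]

/-- The excess after a transposition depends only on the profile at the two positions. -/
def swapExcess (t : ℕ) : Fin 2 × Fin 2 → Fin 2 × Fin 2 → ℕ
  | (1, 1), (0, 0) => t + 1
  | (0, 0), (1, 1) => t + 1
  | (1, 0), (0, 1) => t - 1
  | (0, 1), (1, 0) => t - 1
  | _, _ => t

theorem excess_comp_swap_eq (x y : HammingCube n) (i j : Fin n) :
    excess (x ∘ Equiv.swap i j) y = swapExcess (excess x y) (x i, y i) (x j, y j) := by
  have h01 : ∀ a : Fin 2, a = 0 ∨ a = 1 := by decide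
  rcases h01 (x i) with hi | hi <;> rcases h01 (x j) with hj | hj
  · rw [comp_swap_of_eq (hi.trans hj.symm), hi, hj]
    rcases h01 (y i) with hi' | hi' <;> rcases h01 (y j) with hj' | hj' <;>
      rw [hi', hj'] <;> rfl
  · have := excess_comp_swap (y := y) hj hi
    rw [Equiv.swap_comm] at this
    rcases h01 (y i) with hi' | hi' <;> rcases h01 (y j) with hj' | hj' <;>
      simp only [hi, hj, hi', hj', if_true, one_ne_zero, if_false] at this ⊢ <;>
      simp only [swapExcess] <;> omega
  · have := excess_comp_swap (y := y) hi hj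
    rcases h01 (y i) with hi' | hi' <;> rcases h01 (y j) with hj' | hj' <;>
      simp only [hi, hj, hi', hj', if_true, one_ne_zero, if_false] at this ⊢ <;>
      simp only [swapExcess] <;> omega
  · rw [comp_swap_of_eq (hi.trans hj.symm), hi, hj]
    rcases h01 (y i) with hi' | hi' <;> rcases h01 (y j) with hj' | hj' <;>
      rw [hi', hj'] <;> rfl

theorem sum_profile (x y : HammingCube n) (g : Fin 2 × Fin 2 → ℝ) :
    ∑ i, g (x i, y i) = ∑ c, (profileCount x y c : ℝ) * g c := by
  simp only [profileCount_eq_sum, Nat.cast_sum, Finset.sum_mul]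
  rw [Finset.sum_comm]
  refine Finset.sum_congr rfl fun i _ => ?_
  simp

/-- Summing a function of the excess over all transpositions of the first word. -/
theorem sum_excess_comp_swap {s : ℕ} (hx : x ∈ weightWords n s) (hy : y ∈ weightWords n s)
    (φ : ℕ → ℝ) :
    ∑ i, ∑ j, φ (excess (x ∘ Equiv.swap i j) y) = (n : ℝ) ^ 2 * φ (excess x y) +
      2 * (((s : ℝ) - excess x y) * ((n : ℝ) - s - excess x y) *
          (φ (excess x y + 1) - φ (excess x y)) +
        (excess x y : ℝ) ^ 2 * (φ (excess x y - 1) - φ (excess x y))) := by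
  obtain ⟨h1, h2, h3, h4⟩ := profileCount_of_mem hx hy
  simp only [excess_comp_swap_eq]
  rw [sum_profile x y fun c => ∑ j, φ (swapExcess (excess x y) c (x j, y j))]
  have h : ∀ c, ∑ j, φ (swapExcess (excess x y) c (x j, y j)) =
      ∑ c', (profileCount x y c' : ℝ) * φ (swapExcess (excess x y) c c') := fun c =>
    sum_profile x y fun c' => φ (swapExcess (excess x y) c c')
  simp only [h]
  -- Only `(1,1),(0,0)` and `(1,0),(0,1)`, each in both orders, change the excess; hence the factor
  -- `2`. The terms `i = j` only contribute to `n ^ 2`.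
  simp only [Fintype.sum_prod_type, Fin.sum_univ_two, swapExcess, h1, h2]
  have h3' : (profileCount x y (1, 1) : ℝ) = s - excess x y := by rw [← h3]; push_cast; ring
  have h4' : (profileCount x y (0, 0) : ℝ) = n - s - excess x y := by
    have : ((profileCount x y (0, 0) + s + excess x y : ℕ) : ℝ) = n := by rw [h4]
    push_cast at this
    linarith
  rw [h3', h4']
  ring

end Transpositions

/-! ### The difference equation of the Hahn polynomials. -/

section Hahn

theorem cast_choose_succ_mul (m i : ℕ) :
    (m.choose (i + 1) : ℝ) * (i + 1) = m.choose i * ((m : ℝ) - i) := by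
  rcases le_or_gt i m with h | h
  · rw [← Nat.cast_sub h]
    exact_mod_cast Nat.choose_succ_right_eq m i
  · rw [Nat.choose_eq_zero_of_lt h, Nat.choose_eq_zero_of_lt (by omega)]
    simp

/-- The factor `t` makes the truncated `t - 1` harmless at `t = 0`. -/
theorem cast_mul_choose_pred (t i : ℕ) :
    (t : ℝ) * ((t - 1).choose (i + 1) - t.choose (i + 1)) = -((i + 1) * t.choose (i + 1)) := by
  rcases t with _ | t
  · simp
  · have h := Nat.add_one_mul_choose_eq t i
    have h' : ((t : ℝ) + 1) * t.choose i = (t + 1).choose (i + 1) * (i + 1) := by exact_mod_cast h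
    have h2 : ((t + 1).choose (i + 1) : ℝ) = t.choose i + t.choose (i + 1) := by
      exact_mod_cast Nat.choose_succ_succ t i
    simp only [Nat.add_sub_cancel]
    rw [mul_comm (i + 1 : ℝ), ← h', h2]
    push_cast
    ring

/-- The second-order difference operator on the Johnson scheme, applied to binomials. -/
theorem choose_difference (a b : ℝ) (t i : ℕ) :
    (a - t) * (b - t) * ((t + 1).choose (i + 1) - t.choose (i + 1)) +
      (t : ℝ) ^ 2 * ((t - 1).choose (i + 1) - t.choose (i + 1)) =
    (a - i) * (b - i) * t.choose i - (i + 1) * (a + b - i) * t.choose (i + 1) := by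
  have h1 : ((t + 1).choose (i + 1) : ℝ) = t.choose i + t.choose (i + 1) := by
    exact_mod_cast Nat.choose_succ_succ t i
  have h2 := cast_mul_choose_pred t i
  have h3 := cast_choose_succ_mul t i
  linear_combination (a - t) * (b - t) * h1 + t * h2 + (a + b - i - t) * h3

/-- The coefficients of the Hahn polynomials in the binomial basis. -/
def hahnCoeff (n s k i : ℕ) : ℝ :=
  (-1 : ℝ) ^ i * ((s.choose i : ℝ))⁻¹ * (((n - s).choose i : ℝ))⁻¹ *
    (k.choose i : ℝ) * ((n + 1 - k).choose i : ℝ)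

theorem hahnQ_eq_sum (n s k t : ℕ) :
    hahnQ n s k t = ∑ i ∈ Finset.range (k + 1), hahnCoeff n s k i * t.choose i := rfl

theorem hahnQ_zero_right (n s k : ℕ) : hahnQ n s k 0 = 1 := by
  rw [hahnQ_eq_sum, Finset.sum_range_succ']
  simp [hahnCoeff]

theorem hahnQ_zero_left (n s t : ℕ) : hahnQ n s 0 t = 1 := by
  simp [hahnQ]

/-- The difference operator is bidiagonal in the binomial basis; this two-term recursion is what
makes the coefficients those of an eigenvector. The bound `i < k` keeps the inverted binomials
nonzero. -/
theorem hahnCoeff_succ {n s k i : ℕ} (hk : k ≤ min s (n - s)) (hi : i < k) :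
    hahnCoeff n s k (i + 1) * (((s : ℝ) - i) * ((n : ℝ) - s - i)) =
      -(hahnCoeff n s k i * (((k : ℝ) - i) * ((n : ℝ) + 1 - k - i))) := by
  have e1 : ((n - s : ℕ) : ℝ) = n - s := by
    rw [Nat.cast_sub]
    omega
  have e2 : ((n + 1 - k : ℕ) : ℝ) = n + 1 - k := by
    rw [Nat.cast_sub (by omega)]
    push_cast
    ring
  have h1 := cast_choose_succ_mul s i
  have h2 := cast_choose_succ_mul (n - s) i
  have h3 := cast_choose_succ_mul k i
  have h4 := cast_choose_succ_mul (n + 1 - k) i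
  rw [e1] at h2
  rw [e2] at h4
  have p1 : (s.choose i : ℝ) ≠ 0 := by exact_mod_cast (Nat.choose_pos (by omega)).ne'
  have p2 : (s.choose (i + 1) : ℝ) ≠ 0 := by exact_mod_cast (Nat.choose_pos (by omega)).ne'
  have p3 : ((n - s).choose i : ℝ) ≠ 0 := by exact_mod_cast (Nat.choose_pos (by omega)).ne'
  have p4 : ((n - s).choose (i + 1) : ℝ) ≠ 0 := by
    exact_mod_cast (Nat.choose_pos (by omega)).ne'
  have p5 : (i : ℝ) + 1 ≠ 0 := by positivity
  have q1 : ((s.choose (i + 1) : ℝ))⁻¹ * ((s : ℝ) - i) = (s.choose i : ℝ)⁻¹ * (i + 1) := by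
    field_simp
    linarith
  have q2 : (((n - s).choose (i + 1) : ℝ))⁻¹ * ((n : ℝ) - s - i) =
      ((n - s).choose i : ℝ)⁻¹ * (i + 1) := by
    field_simp
    linarith
  unfold hahnCoeff
  calc _ = (-1 : ℝ) ^ (i + 1) * (((s.choose (i + 1) : ℝ))⁻¹ * ((s : ℝ) - i)) *
        ((((n - s).choose (i + 1) : ℝ))⁻¹ * ((n : ℝ) - s - i)) *
        (k.choose (i + 1) : ℝ) * ((n + 1 - k).choose (i + 1) : ℝ) := by ring
    _ = (-1 : ℝ) ^ (i + 1) * (s.choose i : ℝ)⁻¹ * ((n - s).choose i : ℝ)⁻¹ *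
        ((k.choose (i + 1) : ℝ) * (i + 1)) * (((n + 1 - k).choose (i + 1) : ℝ) * (i + 1)) := by
      rw [q1, q2]; ring
    _ = _ := by rw [h3, h4]; ring

/-- The difference equation of the Hahn polynomials. -/
theorem hahnQ_difference {n s k : ℕ} (hk : k ≤ min s (n - s)) (t : ℕ) :
    ((s : ℝ) - t) * ((n : ℝ) - s - t) * (hahnQ n s k (t + 1) - hahnQ n s k t) +
      (t : ℝ) ^ 2 * (hahnQ n s k (t - 1) - hahnQ n s k t) =
    -((k : ℝ) * (n + 1 - k)) * hahnQ n s k t := by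
  have e : ((s : ℝ) - t) * ((n : ℝ) - s - t) * (hahnQ n s k (t + 1) - hahnQ n s k t) +
      (t : ℝ) ^ 2 * (hahnQ n s k (t - 1) - hahnQ n s k t) =
      ∑ i ∈ Finset.range (k + 1), hahnCoeff n s k i *
        (((s : ℝ) - t) * ((n : ℝ) - s - t) * ((t + 1).choose i - t.choose i) +
          (t : ℝ) ^ 2 * ((t - 1).choose i - t.choose i)) := by
    simp only [hahnQ_eq_sum, ← Finset.sum_sub_distrib, Finset.mul_sum, ← Finset.sum_add_distrib]
    exact Finset.sum_congr rfl fun i _ => by ring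
  rw [e, Finset.sum_range_succ']
  simp only [choose_difference, Nat.choose_zero_right, sub_self, mul_zero, add_zero]
  have e2 : ∀ i ∈ Finset.range k, hahnCoeff n s k (i + 1) *
      (((s : ℝ) - i) * ((n : ℝ) - s - i) * t.choose i -
        (i + 1) * ((s : ℝ) + (n - s) - i) * t.choose (i + 1)) =
      -(hahnCoeff n s k i * (((k : ℝ) - i) * ((n : ℝ) + 1 - k - i)) * t.choose i) -
        hahnCoeff n s k (i + 1) * ((((i + 1 : ℕ) : ℝ)) * ((n : ℝ) + 1 - ((i + 1 : ℕ) : ℝ))) *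
          t.choose (i + 1) := fun i hi => by
    rw [← neg_mul, ← hahnCoeff_succ hk (Finset.mem_range.1 hi)]
    push_cast
    ring
  rw [Finset.sum_congr rfl e2, Finset.sum_sub_distrib]
  -- Both sums extend to `range (k + 1)`, since the added terms contain `k - k` and `0`.
  -- Coefficients then match by `(k - i)(n + 1 - k - i) + i(n + 1 - i) = k(n + 1 - k)`.
  have f1 : ∑ i ∈ Finset.range k,
      -(hahnCoeff n s k i * (((k : ℝ) - i) * ((n : ℝ) + 1 - k - i)) * t.choose i) =
      ∑ i ∈ Finset.range (k + 1),
      -(hahnCoeff n s k i * (((k : ℝ) - i) * ((n : ℝ) + 1 - k - i)) * t.choose i) := by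
    rw [Finset.sum_range_succ]
    simp
  have f2 : ∑ i ∈ Finset.range k, hahnCoeff n s k (i + 1) *
      ((((i + 1 : ℕ) : ℝ)) * ((n : ℝ) + 1 - ((i + 1 : ℕ) : ℝ))) * t.choose (i + 1) =
      ∑ i ∈ Finset.range (k + 1), hahnCoeff n s k i * ((i : ℝ) * ((n : ℝ) + 1 - i)) *
        t.choose i := by
    rw [Finset.sum_range_succ']
    simp
  rw [f1, f2, ← Finset.sum_sub_distrib, hahnQ_eq_sum, Finset.mul_sum]
  exact Finset.sum_congr rfl fun i _ => by ring

/-- A solution of the difference equation that vanishes at `0` vanishes identically. -/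
theorem eq_zero_of_difference {n s : ℕ} {θ : ℝ} {φ : ℕ → ℝ}
    (h : ∀ t ≤ min s (n - s), ((s : ℝ) - t) * ((n : ℝ) - s - t) * (φ (t + 1) - φ t) +
      (t : ℝ) ^ 2 * (φ (t - 1) - φ t) = θ * φ t) (h0 : φ 0 = 0) :
    ∀ t ≤ min s (n - s), φ t = 0 := by
  intro t
  induction t using Nat.strong_induction_on with
  | _ t ih =>
    intro ht
    rcases t with _ | t
    · exact h0
    -- The equation at `t` determines `φ (t + 1)`, as its coefficient `(s - t)(n - s - t)` is
    -- nonzero below `min s (n - s)`.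
    · have h1 := h t (by omega)
      rw [ih t (by omega) (by omega), ih (t - 1) (by omega) (by omega)] at h1
      have p1 : (s : ℝ) - t ≠ 0 := by
        have : (t : ℝ) < s := by exact_mod_cast (by omega : t < s)
        linarith
      have p2 : (n : ℝ) - s - t ≠ 0 := by
        have : ((s + t : ℕ) : ℝ) < n := by exact_mod_cast (by omega : s + t < n)
        push_cast at this
        linarith
      simpa [p1, p2] using h1

/-- The map `x ↦ x(n + 1 - x)` identifies only points with sum `n + 1`, while `j + k ≤ n`. -/
theorem hahn_eigenvalue_injective {n s j k : ℕ} (hj : j ≤ min s (n - s))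
    (hk : k ≤ min s (n - s)) (h : (j : ℝ) * (n + 1 - j) = k * (n + 1 - k)) : j = k := by
  have h1 : ((j : ℝ) - k) * (n + 1 - j - k) = 0 := by linear_combination h
  have h2 : ((j + k : ℕ) : ℝ) < n + 1 := by exact_mod_cast (by omega : j + k < n + 1)
  push_cast at h2
  rcases mul_eq_zero.1 h1 with h3 | h3
  · exact_mod_cast sub_eq_zero.1 h3
  · linarith

end Hahn

/-! ### The algebra of the Johnson scheme and its zonal Hahn matrices. -/

section Zonal

variable {n s : ℕ}

instance weightWords.instFintype (n s : ℕ) : Fintype (weightWords n s) := Fintype.ofFinite _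

/-- The action of a permutation of the positions on the words of weight `s`. -/
def weightWordsPerm (σ : Equiv.Perm (Fin n)) : Equiv.Perm (weightWords n s) where
  toFun x := ⟨(x : HammingCube n) ∘ σ, (hammingNorm_comp_perm σ x).trans x.2⟩
  invFun x := ⟨(x : HammingCube n) ∘ σ.symm, (hammingNorm_comp_perm σ.symm x).trans x.2⟩
  left_inv x := by ext; simp
  right_inv x := by ext; simp

theorem coe_weightWordsPerm (σ : Equiv.Perm (Fin n)) (x : weightWords n s) :
    (weightWordsPerm σ x : HammingCube n) = (x : HammingCube n) ∘ σ := rfl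

/-- The matrix whose entry at `(x, y)` is a given function of the excess. -/
def zonal (n s : ℕ) (φ : ℕ → ℝ) : Matrix (weightWords n s) (weightWords n s) ℝ :=
  Matrix.of fun x y => φ (excess (x : HammingCube n) y)

@[simp]
theorem zonal_apply (φ : ℕ → ℝ) (x y : weightWords n s) :
    zonal n s φ x y = φ (excess (x : HammingCube n) y) := rfl

/-- A matrix is invariant if it is unchanged by all permutations of the positions. -/
def IsPermInvariant (M : Matrix (weightWords n s) (weightWords n s) ℝ) : Prop :=
  ∀ σ x y, M (weightWordsPerm σ x) (weightWordsPerm σ y) = M x y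

theorem isPermInvariant_zonal (φ : ℕ → ℝ) : IsPermInvariant (zonal n s φ) := fun σ x y => by
  simp [coe_weightWordsPerm, excess_comp_perm]

theorem IsPermInvariant.mul {M N : Matrix (weightWords n s) (weightWords n s) ℝ}
    (hM : IsPermInvariant M) (hN : IsPermInvariant N) : IsPermInvariant (M * N) := by
  intro σ x y
  rw [Matrix.mul_apply, Matrix.mul_apply, ← Equiv.sum_comp (weightWordsPerm σ)]
  exact Finset.sum_congr rfl fun z _ => by rw [hM, hN]

theorem IsPermInvariant.exists_eq_zonal {M : Matrix (weightWords n s) (weightWords n s) ℝ}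
    (hM : IsPermInvariant M) : ∃ φ, M = zonal n s φ := by
  classical
  refine ⟨fun t => if h : ∃ p : weightWords n s × weightWords n s,
    excess (p.1 : HammingCube n) p.2 = t then M h.choose.1 h.choose.2 else 0, ?_⟩
  ext x y
  have h : ∃ p : weightWords n s × weightWords n s,
    excess (p.1 : HammingCube n) p.2 = excess (x : HammingCube n) y := ⟨(x, y), rfl⟩
  rw [zonal_apply, dif_pos h]
  obtain ⟨σ, h1, h2⟩ := exists_perm_of_excess_eq h.choose.1.2 h.choose.2.2 x.2 y.2 h.choose_spec
  rw [← hM σ h.choose.1 h.choose.2]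
  congr 1 <;> exact Subtype.ext (by simp [coe_weightWordsPerm, h1, h2])

theorem zonal_transpose (φ : ℕ → ℝ) : (zonal n s φ).transpose = zonal n s φ := by
  ext x y
  simp [excess_comm x.2 y.2]

/-- The product is invariant, hence zonal, hence symmetric; symmetric matrices with symmetric
product commute. -/
theorem zonal_mul_comm (φ ψ : ℕ → ℝ) :
    zonal n s φ * zonal n s ψ = zonal n s ψ * zonal n s φ := by
  obtain ⟨χ, hχ⟩ :=
    ((isPermInvariant_zonal (n := n) (s := s) φ).mul (isPermInvariant_zonal ψ)).exists_eq_zonal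
  rw [hχ, ← zonal_transpose χ, ← hχ, Matrix.transpose_mul, zonal_transpose, zonal_transpose]

/-- The sum of the permutation matrices of all transpositions. -/
def swapMatrix (n s : ℕ) : Matrix (weightWords n s) (weightWords n s) ℝ :=
  Matrix.of fun x z => ∑ i, ∑ j, if weightWordsPerm (Equiv.swap i j) x = z then 1 else 0

/-- Conjugation by `σ` permutes the transpositions. -/
theorem isPermInvariant_swapMatrix : IsPermInvariant (swapMatrix n s) := by
  intro σ x z
  simp only [swapMatrix, Matrix.of_apply]
  symm
  rw [← Equiv.sum_comp σ]
  refine Finset.sum_congr rfl fun i _ => ?_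
  rw [← Equiv.sum_comp σ]
  refine Finset.sum_congr rfl fun j _ => ?_
  congr 1
  rw [← (weightWordsPerm σ).apply_eq_iff_eq (x := weightWordsPerm (Equiv.swap (σ i) (σ j)) x)]
  congr 1
  ext l
  simp [coe_weightWordsPerm, Equiv.swap_apply_apply]

theorem swapMatrix_mul_zonal_apply (φ : ℕ → ℝ) (x y : weightWords n s) :
    (swapMatrix n s * zonal n s φ) x y =
      (n : ℝ) ^ 2 * φ (excess (x : HammingCube n) y) +
      2 * (((s : ℝ) - excess (x : HammingCube n) y) * ((n : ℝ) - s - excess (x : HammingCube n) y) *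
          (φ (excess (x : HammingCube n) y + 1) - φ (excess (x : HammingCube n) y)) +
        (excess (x : HammingCube n) y : ℝ) ^ 2 *
          (φ (excess (x : HammingCube n) y - 1) - φ (excess (x : HammingCube n) y))) := by
  rw [← sum_excess_comp_swap x.2 y.2 φ, Matrix.mul_apply]
  simp only [swapMatrix, Matrix.of_apply, Finset.sum_mul]
  rw [Finset.sum_comm]
  refine Finset.sum_congr rfl fun i _ => ?_
  rw [Finset.sum_comm]
  refine Finset.sum_congr rfl fun j _ => ?_
  simp [coe_weightWordsPerm]

theorem swapMatrix_mul_hahn {k : ℕ} (hk : k ≤ min s (n - s)) :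
    swapMatrix n s * zonal n s (hahnQ n s k) =
      ((n : ℝ) ^ 2 - 2 * (k * (n + 1 - k))) • zonal n s (hahnQ n s k) := by
  ext x y
  rw [swapMatrix_mul_zonal_apply, hahnQ_difference hk, Matrix.smul_apply, zonal_apply,
    smul_eq_mul]
  ring

theorem swapMatrix_mul_zonal (φ : ℕ → ℝ) :
    swapMatrix n s * zonal n s φ = zonal n s φ * swapMatrix n s := by
  obtain ⟨χ, hχ⟩ := (isPermInvariant_swapMatrix (n := n) (s := s)).exists_eq_zonal
  rw [hχ, zonal_mul_comm]

/-- The zonal Hahn matrices are common eigenvectors of the Johnson scheme. -/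
theorem zonal_mul_hahn {k : ℕ} (hk : k ≤ min s (n - s)) (φ : ℕ → ℝ) (x₀ : weightWords n s) :
    zonal n s φ * zonal n s (hahnQ n s k) =
      (∑ y : weightWords n s, φ (excess (x₀ : HammingCube n) y) *
        hahnQ n s k (excess (x₀ : HammingCube n) y)) • zonal n s (hahnQ n s k) := by
  obtain ⟨χ, hχ⟩ := ((isPermInvariant_zonal (n := n) (s := s) φ).mul
    (isPermInvariant_zonal (hahnQ n s k))).exists_eq_zonal
  have h00 : excess (x₀ : HammingCube n) x₀ = 0 := (excess_eq_zero_iff x₀.2 x₀.2).2 rfl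
  have h0 : χ 0 = ∑ y : weightWords n s, φ (excess (x₀ : HammingCube n) y) *
      hahnQ n s k (excess (x₀ : HammingCube n) y) := by
    have := congrFun (congrFun hχ x₀) x₀
    rw [zonal_apply, h00] at this
    rw [← this, Matrix.mul_apply]
    refine Finset.sum_congr rfl fun y _ => ?_
    rw [zonal_apply, zonal_apply, excess_comm y.2 x₀.2]
  have hT : swapMatrix n s * zonal n s χ =
      ((n : ℝ) ^ 2 - 2 * (k * (n + 1 - k))) • zonal n s χ := by
    rw [← hχ, ← Matrix.mul_assoc, swapMatrix_mul_zonal, Matrix.mul_assoc, swapMatrix_mul_hahn hk,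
      Matrix.mul_smul]
  -- `χ` and `χ 0 * hahnQ n s k` solve the same difference equation and agree at `0`, so they
  -- coincide; the diagonal entry gave `χ 0`.
  have hz := eq_zero_of_difference (n := n) (s := s) (θ := -((k : ℝ) * (n + 1 - k)))
    (φ := fun t => χ t - χ 0 * hahnQ n s k t) (fun t ht => by
      obtain ⟨y, hy, hyt⟩ := exists_excess_eq x₀.2 ht
      have h1 := congrFun (congrFun hT x₀) ⟨y, hy⟩
      rw [swapMatrix_mul_zonal_apply, Matrix.smul_apply, zonal_apply, smul_eq_mul] at h1
      simp only [hyt] at h1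
      have h2 := hahnQ_difference hk t
      linear_combination h1 / 2 - χ 0 * h2) (by simp [hahnQ_zero_right])
  rw [hχ, ← h0]
  ext x y
  have := hz _ (excess_le x.2 y.2)
  simp only [zonal_apply, Matrix.smul_apply, smul_eq_mul]
  linarith

theorem sum_hahnQ_sq_pos (k : ℕ) (x₀ : weightWords n s) :
    0 < ∑ y : weightWords n s, hahnQ n s k (excess (x₀ : HammingCube n) y) *
      hahnQ n s k (excess (x₀ : HammingCube n) y) := by
  refine Finset.sum_pos' (fun y _ => mul_self_nonneg _) ⟨x₀, Finset.mem_univ _, ?_⟩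
  rw [(excess_eq_zero_iff x₀.2 x₀.2).2 rfl, hahnQ_zero_right]
  norm_num

/-- The zonal Hahn matrices are positive semidefinite. -/
theorem posSemidef_zonal_hahn {k : ℕ} (hk : k ≤ min s (n - s)) :
    (zonal n s (hahnQ n s k)).PosSemidef := by
  rcases isEmpty_or_nonempty (weightWords n s) with h | ⟨⟨x₀⟩⟩
  · convert Matrix.PosSemidef.zero
    ext x
    exact h.elim x
  · have h := zonal_mul_hahn hk (hahnQ n s k) x₀
    have hp := sum_hahnQ_sq_pos k x₀
    rw [eq_comm, ← eq_inv_smul_iff₀ hp.ne'] at h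
    rw [h]
    -- From `E² = ν E` with `ν > 0` and `E` symmetric, `E = ν⁻¹ Eᵀ E`.
    refine Matrix.PosSemidef.smul ?_ (inv_nonneg.2 hp.le)
    conv =>
      arg 1
      arg 1
      rw [← zonal_transpose]
    rw [← Matrix.conjTranspose_eq_transpose_of_trivial]
    exact Matrix.posSemidef_conjTranspose_mul_self _

/-- Since `E = ν⁻¹ E²`, the trace is `ν⁻¹ tr(E F Eᵀ)`. -/
theorem trace_mul_hahn_nonneg {k : ℕ} (hk : k ≤ min s (n - s))
    {F : Matrix (weightWords n s) (weightWords n s) ℝ} (hF : F.PosSemidef) :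
    0 ≤ (F * zonal n s (hahnQ n s k)).trace := by
  rcases isEmpty_or_nonempty (weightWords n s) with h | ⟨⟨x₀⟩⟩
  · simp [Matrix.trace]
  · have h := zonal_mul_hahn hk (hahnQ n s k) x₀
    have hp := sum_hahnQ_sq_pos k x₀
    rw [eq_comm, ← eq_inv_smul_iff₀ hp.ne'] at h
    rw [h, Matrix.mul_smul, Matrix.trace_smul, ← Matrix.mul_assoc, Matrix.trace_mul_comm,
      ← Matrix.mul_assoc]
    refine mul_nonneg (inv_nonneg.2 hp.le) ?_
    have := (hF.mul_mul_conjTranspose_same (zonal n s (hahnQ n s k))).trace_nonneg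
    rwa [Matrix.conjTranspose_eq_transpose_of_trivial, zonal_transpose] at this

/-- The zonal Hahn matrices are eigenvectors of left multiplication by `swapMatrix n s` for distinct
eigenvalues. -/
theorem linearIndependent_hahn (h : s ≤ n) :
    LinearIndependent ℝ fun (k t : Fin (min s (n - s) + 1)) => hahnQ n s k t := by
  obtain ⟨x₀, hx₀⟩ := weightWords_nonempty h
  let Z : (Fin (min s (n - s) + 1) → ℝ) →ₗ[ℝ] Matrix (weightWords n s) (weightWords n s) ℝ :=
    { toFun := fun φ => Matrix.of fun x y =>
        φ ⟨excess (x : HammingCube n) y, Nat.lt_succ_of_le (excess_le x.2 y.2)⟩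
      map_add' := fun _ _ => rfl
      map_smul' := fun _ _ => rfl }
  refine LinearIndependent.of_comp Z ?_
  refine Module.End.eigenvectors_linearIndependent' (LinearMap.mulLeft ℝ (swapMatrix n s))
    (fun k : Fin (min s (n - s) + 1) => (n : ℝ) ^ 2 - 2 * ((k : ℕ) * (n + 1 - (k : ℕ))))
    (fun j k hjk => ?_) _ fun k => ⟨?_, fun h0 => ?_⟩
  · refine Fin.ext (hahn_eigenvalue_injective (Nat.le_of_lt_succ j.2) (Nat.le_of_lt_succ k.2) ?_)
    simp only at hjk
    linarith
  · rw [Module.End.mem_eigenspace_iff]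
    exact swapMatrix_mul_hahn (Nat.le_of_lt_succ k.2)
  · have h1 : hahnQ n s k (excess x₀ x₀) = 0 := congrFun (congrFun h0 ⟨x₀, hx₀⟩) ⟨x₀, hx₀⟩
    rw [(excess_eq_zero_iff hx₀ hx₀).2 rfl, hahnQ_zero_right] at h1
    exact one_ne_zero h1

/-- The decomposition of the identity into zonal Hahn matrices. -/
theorem exists_one_eq_sum_hahn (h : s ≤ n) : ∃ c : ℕ → ℝ, (∀ k, 0 ≤ c k) ∧
    c 0 * (weightWords n s).ncard = 1 ∧
    (1 : Matrix (weightWords n s) (weightWords n s) ℝ) =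
      ∑ k ∈ Finset.range (min s (n - s) + 1), c k • zonal n s (hahnQ n s k) := by
  obtain ⟨x₀, hx₀⟩ := weightWords_nonempty h
  have hli := linearIndependent_hahn h
  let b := basisOfLinearIndependentOfCardEqFinrank hli (by simp)
  have hb : ∀ k, b k = fun t : Fin (min s (n - s) + 1) => hahnQ n s k t := fun k => by simp [b]
  let δ : Fin (min s (n - s) + 1) → ℝ := fun t => if (t : ℕ) = 0 then 1 else 0
  have hδ := b.sum_repr δ
  have h1 : (1 : Matrix (weightWords n s) (weightWords n s) ℝ) =
      ∑ k : Fin (min s (n - s) + 1), b.repr δ k • zonal n s (hahnQ n s k) := by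
    ext x y
    have h2 := congrFun hδ ⟨excess (x : HammingCube n) y, Nat.lt_succ_of_le (excess_le x.2 y.2)⟩
    simp only [hb, Finset.sum_apply, Pi.smul_apply, δ, excess_eq_zero_iff x.2 y.2] at h2
    simp only [Matrix.sum_apply, Matrix.smul_apply, zonal_apply, Matrix.one_apply, Subtype.ext_iff]
    exact h2.symm
  let ν : ℕ → ℝ := fun k => ∑ y : weightWords n s, hahnQ n s k (excess x₀ y) *
      hahnQ n s k (excess x₀ y)
  have hν : ∀ k, 0 < ν k := fun k => sum_hahnQ_sq_pos k ⟨x₀, hx₀⟩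
  have hsq : ∀ k ≤ min s (n - s), zonal n s (hahnQ n s k) * zonal n s (hahnQ n s k) =
      ν k • zonal n s (hahnQ n s k) := fun k hk => zonal_mul_hahn hk _ ⟨x₀, hx₀⟩
  have h00 : excess x₀ x₀ = 0 := (excess_eq_zero_iff hx₀ hx₀).2 rfl
  have hne : ∀ k, zonal n s (hahnQ n s k) ≠ 0 := fun k h0 => by
    have h1 : hahnQ n s k (excess x₀ x₀) = 0 := congrFun (congrFun h0 ⟨x₀, hx₀⟩) ⟨x₀, hx₀⟩
    rw [h00, hahnQ_zero_right] at h1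
    exact one_ne_zero h1
  have horth : ∀ j ≤ min s (n - s), ∀ k ≤ min s (n - s), j ≠ k →
      zonal n s (hahnQ n s k) * zonal n s (hahnQ n s j) = 0 := fun j hj k hk hjk => by
    by_contra hne0
    have e1 := congrArg (zonal n s (hahnQ n s k) * ·) (swapMatrix_mul_hahn hj)
    simp only [Matrix.mul_smul] at e1
    rw [← Matrix.mul_assoc, ← swapMatrix_mul_zonal, swapMatrix_mul_hahn hk, Matrix.smul_mul] at e1
    have e2 := smul_left_injective ℝ hne0 e1
    exact hjk (hahn_eigenvalue_injective hj hk (by linarith))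
  -- Multiplying the expansion of `1` by `E_j` leaves only the `j`-th term, by orthogonality; so the
  -- coefficient is `1 / ν j > 0`.
  have hc : ∀ j : Fin (min s (n - s) + 1), b.repr δ j * ν j = 1 := fun j => by
    have e := congrArg (· * zonal n s (hahnQ n s j)) h1
    simp only [Matrix.one_mul, Finset.sum_mul, Matrix.smul_mul] at e
    rw [Finset.sum_eq_single j (fun k _ hk => by
      rw [horth _ (Nat.le_of_lt_succ j.2) _ (Nat.le_of_lt_succ k.2)
        (fun h => hk (Fin.ext h.symm)), smul_zero]) (by simp), hsq _ (Nat.le_of_lt_succ j.2),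
        smul_smul] at e
    have e' : (1 : ℝ) • zonal n s (hahnQ n s j) =
      (b.repr δ j * ν j) • zonal n s (hahnQ n s j) := by rw [one_smul]; exact e
    exact (smul_left_injective ℝ (hne j) e').symm
  have hc' : ∀ j : Fin (min s (n - s) + 1), b.repr δ j = (ν j)⁻¹ := fun j =>
    eq_inv_of_mul_eq_one_left (hc j)
  refine ⟨fun k => (ν k)⁻¹, fun k => (inv_pos.2 (hν k)).le, ?_, ?_⟩
  · have : ν 0 = (weightWords n s).ncard := by
      rw [← Nat.card_coe_set_eq, Nat.card_eq_fintype_card]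
      simp [ν, hahnQ_zero_left]
    rw [← this]
    exact inv_mul_cancel₀ (hν 0).ne'
  · rw [h1, ← Fin.sum_univ_eq_sum_range fun k => (ν k)⁻¹ • zonal n s (hahnQ n s k)]
    exact Finset.sum_congr rfl fun j _ => by rw [hc']

end Zonal

/-! ### The spectral bound and a matrix attaining it. -/

section Bounds

variable {n s : ℕ}

/-- Eigenvalues of the graph of pairs with excess `t₀`: the degree times the Hahn value. -/
theorem zonal_indicator_mul_hahn {k t₀ : ℕ} (hk : k ≤ min s (n - s)) (x₀ : weightWords n s) :
    zonal n s (fun t => if t = t₀ then 1 else 0) * zonal n s (hahnQ n s k) =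
      ((∑ y : weightWords n s, if excess (x₀ : HammingCube n) y = t₀ then (1 : ℝ) else 0) *
        hahnQ n s k t₀) • zonal n s (hahnQ n s k) := by
  rw [zonal_mul_hahn hk _ x₀, Finset.sum_mul]
  congr 1
  refine Finset.sum_congr rfl fun y _ => ?_
  split_ifs with h
  · rw [h]
  · simp

theorem sum_indicator_pos {t₀ : ℕ} (ht : t₀ ≤ min s (n - s)) (x₀ : weightWords n s) :
    0 < ∑ y : weightWords n s, if excess (x₀ : HammingCube n) y = t₀ then (1 : ℝ) else 0 := by
  obtain ⟨y, hy, hyt⟩ := exists_excess_eq x₀.2 ht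
  exact Finset.sum_pos' (fun y _ => by split_ifs <;> norm_num)
    ⟨⟨y, hy⟩, Finset.mem_univ _, by simp [hyt]⟩

/-- Some Hahn polynomial is negative at each positive integer. -/
theorem exists_hahnQ_neg (h : s ≤ n) {t₀ : ℕ} (ht : t₀ ≤ min s (n - s)) (ht0 : 0 < t₀) :
    ∃ k ≤ min s (n - s), hahnQ n s k t₀ < 0 := by
  by_contra! hneg
  obtain ⟨x₀, hx₀⟩ := weightWords_nonempty h
  obtain ⟨y, hy, hyt⟩ := exists_excess_eq hx₀ ht
  obtain ⟨c, hc, -, h1⟩ := exists_one_eq_sum_hahn h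
  have hd := sum_indicator_pos ht ⟨x₀, hx₀⟩
  -- Nonnegative eigenvalues would make the adjacency matrix positive semidefinite; its trace is
  -- `0`, so it would vanish, yet its entry at `(x₀, y)` is `1`.
  have hA : (zonal n s fun t => if t = t₀ then 1 else 0).PosSemidef := by
    rw [← Matrix.mul_one (zonal n s fun t => if t = t₀ then 1 else 0), h1, Finset.mul_sum]
    refine Matrix.posSemidef_sum _ fun k hk => ?_
    have hk' := Nat.le_of_lt_succ (Finset.mem_range.1 hk)
    rw [Matrix.mul_smul, zonal_indicator_mul_hahn hk' ⟨x₀, hx₀⟩]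
    exact ((posSemidef_zonal_hahn hk').smul (mul_nonneg hd.le (hneg k hk'))).smul (hc k)
  have htr : (zonal n s fun t => if t = t₀ then 1 else 0).trace = 0 := by
    refine Finset.sum_eq_zero fun x _ => ?_
    rw [Matrix.diag_apply, zonal_apply, (excess_eq_zero_iff x.2 x.2).2 rfl, if_neg ht0.ne]
  rw [hA.trace_eq_zero_iff] at htr
  have := congrFun (congrFun htr ⟨x₀, hx₀⟩) ⟨y, hy⟩
  simp [hyt] at this

/-- The spectral upper bound on the trace of a feasible matrix. -/
theorem trace_le_of_feasible (h : s ≤ n) {t₀ : ℕ} (ht : t₀ ≤ min s (n - s)) {M : ℝ} (hM : M < 0)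
    (hMk : ∀ k ≤ min s (n - s), M ≤ hahnQ n s k t₀)
    {F : Matrix (weightWords n s) (weightWords n s) ℝ}
    (hF : (F - Matrix.vecMulVec F.diag F.diag).PosSemidef)
    (h0 : ∀ x y : weightWords n s, excess (x : HammingCube n) y = t₀ → F x y = 0) :
    F.trace ≤ (weightWords n s).ncard * (M / (M - 1)) := by
  obtain ⟨x₀, hx₀⟩ := weightWords_nonempty h
  obtain ⟨c, hc, hc0, h1⟩ := exists_one_eq_sum_hahn h
  have hd := sum_indicator_pos ht ⟨x₀, hx₀⟩
  have hFp : F.PosSemidef := by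
    have := hF.add (Matrix.posSemidef_vecMulVec_self_star F.diag)
    simpa using this
  set a : ℕ → ℝ := fun k => c k * (F * zonal n s (hahnQ n s k)).trace with ha
  have ha0 : ∀ k ∈ Finset.range (min s (n - s) + 1), 0 ≤ a k := fun k hk =>
    mul_nonneg (hc k) (trace_mul_hahn_nonneg (Nat.le_of_lt_succ (Finset.mem_range.1 hk)) hFp)
  have hsum : F.trace = ∑ k ∈ Finset.range (min s (n - s) + 1), a k := by
    conv_lhs => rw [← Matrix.mul_one F, h1, Finset.mul_sum, Matrix.trace_sum]
    simp [ha]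
  have hFA : (F * zonal n s fun t => if t = t₀ then 1 else 0).trace = 0 := by
    refine Finset.sum_eq_zero fun x _ => ?_
    rw [Matrix.diag_apply, Matrix.mul_apply]
    refine Finset.sum_eq_zero fun y _ => ?_
    rw [zonal_apply, excess_comm y.2 x.2]
    split_ifs with hxy
    · rw [h0 x y hxy, zero_mul]
    · rw [mul_zero]
  have hsumQ : ∑ k ∈ Finset.range (min s (n - s) + 1), a k * hahnQ n s k t₀ = 0 := by
    rw [← Matrix.mul_one (zonal n s fun t => if t = t₀ then 1 else 0), h1, Finset.mul_sum,
      Finset.mul_sum, Matrix.trace_sum, Finset.sum_congr rfl fun k hk => by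
        rw [Matrix.mul_smul, zonal_indicator_mul_hahn
          (Nat.le_of_lt_succ (Finset.mem_range.1 hk)) ⟨x₀, hx₀⟩, smul_smul, Matrix.mul_smul,
          Matrix.trace_smul, smul_eq_mul]] at hFA
    apply mul_left_cancel₀ hd.ne'
    rw [mul_zero]
    refine Eq.trans ?_ hFA
    rw [Finset.mul_sum]
    exact Finset.sum_congr rfl fun k _ => by simp only [ha]; ring
  have hN : (0 : ℝ) < (weightWords n s).ncard := by
    rcases (Nat.cast_nonneg (α := ℝ) (weightWords n s).ncard).lt_or_eq with h | h
    · exact h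
    · rw [← h, mul_zero] at hc0
      exact absurd hc0 zero_ne_one
  -- Pair `F - f fᵀ ⪰ 0` with `E_0`, the all-ones matrix, and use `c 0 = 1 / N`.
  have hfirst : F.trace ^ 2 ≤ (weightWords n s).ncard * a 0 := by
    have e := trace_mul_hahn_nonneg (Nat.zero_le _) hF
    rw [Matrix.sub_mul, Matrix.trace_sub] at e
    have e2 : (Matrix.vecMulVec F.diag F.diag * zonal n s (hahnQ n s 0)).trace = F.trace ^ 2 := by
      rw [sq]
      simp only [Matrix.trace, Matrix.diag_apply, Matrix.mul_apply, Matrix.vecMulVec_apply,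
        zonal_apply, hahnQ_zero_left, mul_one]
      rw [Finset.sum_mul_sum]
    have e3 : (weightWords n s).ncard * a 0 = (F * zonal n s (hahnQ n s 0)).trace := by
      simp only [ha]
      rw [← mul_assoc, mul_comm _ (c 0), hc0, one_mul]
    rw [e3]
    linarith
  -- In `∑ a k * Q_k(t₀) = 0`, keep `Q_0 = 1` exactly and bound the other values below by `M`.
  have hkey : a 0 * (1 - M) ≤ -M * F.trace := by
    rw [hsum]
    have e : ∑ k ∈ Finset.range (min s (n - s) + 1), a k * M + a 0 * (1 - M) ≤
        ∑ k ∈ Finset.range (min s (n - s) + 1), a k * hahnQ n s k t₀ := by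
      rw [Finset.sum_range_succ', Finset.sum_range_succ', hahnQ_zero_left]
      have : ∑ k ∈ Finset.range (min s (n - s)), a (k + 1) * M ≤
          ∑ k ∈ Finset.range (min s (n - s)), a (k + 1) * hahnQ n s (k + 1) t₀ := by
        refine Finset.sum_le_sum fun k hk => ?_
        have hk' := Finset.mem_range.1 hk
        exact mul_le_mul_of_nonneg_left (hMk _ hk') (ha0 _ (Finset.mem_range.2 (by omega)))
      linarith
    rw [hsumQ, ← Finset.sum_mul] at e
    linarith
  -- Combines `hfirst` and `hkey`; cancelling `F.trace` needs it positive, and otherwise the bound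
  -- is trivial.
  have hquad : F.trace * (F.trace * (1 - M)) ≤
      F.trace * ((weightWords n s).ncard * (-M)) := by nlinarith
  have hrw : (weightWords n s).ncard * (M / (M - 1)) =
      (weightWords n s).ncard * (-M) / (1 - M) := by
    rw [← neg_sub 1 M, div_neg, neg_eq_neg_one_mul, neg_eq_neg_one_mul M]
    ring
  rw [hrw, le_div_iff₀ (by linarith)]
  rcases le_or_gt F.trace 0 with ht | ht
  · nlinarith
  · exact le_of_mul_le_mul_left hquad ht

/-- A feasible matrix that attains the spectral bound. -/
theorem exists_feasible {t₀ k : ℕ} (hk : k ≤ min s (n - s)) (hM : hahnQ n s k t₀ < 0) :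
    ∃ F : Matrix (weightWords n s) (weightWords n s) ℝ,
      (F - Matrix.vecMulVec F.diag F.diag).PosSemidef ∧
      (∀ x y : weightWords n s, excess (x : HammingCube n) y = t₀ → F x y = 0) ∧
      F.trace = (weightWords n s).ncard * (hahnQ n s k t₀ / (hahnQ n s k t₀ - 1)) := by
  set M := hahnQ n s k t₀ with hMdef
  have hM1 : M - 1 ≠ 0 := by linarith
  -- This `c` solves `c² (1 - 1 / M) = c`: the diagonal of `c² (J - E_k / M)` is then `c`, and
  -- subtracting `f fᵀ = c² J` leaves `-(c² / M) E_k ⪰ 0`.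
  set c := M / (M - 1) with hc
  have hdiag : ∀ x : weightWords n s, c ^ 2 + -(c ^ 2 / M) * hahnQ n s k
      (excess (x : HammingCube n) x) = c := fun x => by
    rw [(excess_eq_zero_iff x.2 x.2).2 rfl, hahnQ_zero_right, hc]
    field_simp [hM.ne]
    ring
  refine ⟨zonal n s fun t => c ^ 2 + -(c ^ 2 / M) * hahnQ n s k t, ?_, ?_, ?_⟩
  · have e : (zonal n s fun t => c ^ 2 + -(c ^ 2 / M) * hahnQ n s k t) -
        Matrix.vecMulVec (zonal n s fun t => c ^ 2 + -(c ^ 2 / M) * hahnQ n s k t).diag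
          (zonal n s fun t => c ^ 2 + -(c ^ 2 / M) * hahnQ n s k t).diag =
        (-(c ^ 2 / M)) • zonal n s (hahnQ n s k) := by
      ext x y
      simp only [Matrix.sub_apply, Matrix.vecMulVec_apply, Matrix.diag_apply, zonal_apply, hdiag,
        Matrix.smul_apply, smul_eq_mul]
      ring
    rw [e]
    refine (posSemidef_zonal_hahn hk).smul ?_
    rw [← div_neg]
    exact div_nonneg (sq_nonneg _) (by linarith)
  · intro x y hxy
    rw [zonal_apply, hxy, ← hMdef]
    field_simp [hM.ne]
    ring
  · rw [Matrix.trace, ← Nat.card_coe_set_eq, Nat.card_eq_fintype_card]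
    simp only [Matrix.diag_apply, zonal_apply, hdiag]
    simp

end Bounds

/-! ### The theta body of a graph in Lovász form. -/

/-- Schur complement of the corner entry `1`. -/
theorem borderedMatrix_posSemidef_iff {ι : Type*} [Finite ι] (F : Matrix ι ι ℝ) :
    (borderedMatrix F).PosSemidef ↔ (F - Matrix.vecMulVec F.diag F.diag).PosSemidef := by
  let : Invertible (1 : Matrix Unit Unit ℝ) := invertibleOne
  have h := Matrix.PosDef.fromBlocks₁₁ (A := (1 : Matrix Unit Unit ℝ))
    (Matrix.of fun _ y => F y y) F Matrix.PosDef.one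
  have e1 : (Matrix.of fun (_ : Unit) y => F y y).conjTranspose =
    Matrix.of fun x (_ : Unit) => F x x := by ext; simp
  have e2 : (Matrix.of fun x (_ : Unit) => F x x) * (1 : Matrix Unit Unit ℝ)⁻¹ *
      (Matrix.of fun (_ : Unit) y => F y y) = Matrix.vecMulVec F.diag F.diag := by
    ext
    simp [Matrix.mul_apply, Matrix.vecMulVec_apply]
  rw [e1, e2] at h
  exact h

namespace UniformHypergraph

variable {α : Type*}

theorem mem_link_vertexSet_iff (H : UniformHypergraph α 2) (x y : α) :
    y ∈ (H.link x).vertexSet ↔ y ≠ x ∧ {x, y} ∈ H.edgeSet := by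
  constructor
  · rintro ⟨hyx, e, he, hxe, hye⟩
    refine ⟨hyx, ?_⟩
    have hsub : ({x, y} : Set α) ⊆ e := Set.insert_subset hxe (Set.singleton_subset_iff.2 hye)
    have hc := H.encard_edge e he
    have heq : ({x, y} : Set α) = e :=
      (Set.toFinite _).eq_of_subset_of_encard_le hsub (by
        rw [hc, Set.encard_pair hyx.symm]
        rfl)
    rwa [heq]
  · rintro ⟨hyx, he⟩
    exact ⟨hyx, _, he, by simp, by simp⟩

/-- Every vertex of a link in a graph forms an edge of the link, so that only the zero function lies
in its theta body. -/
theorem thetaBody_link_eq_zero (H : UniformHypergraph α 2) (x : α) :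
    thetaBody 1 (H.link x) = {0} := by
  have h : ∀ I : Set α, (H.link x).IsIndependent I ↔ I = ∅ := fun I => by
    refine ⟨fun ⟨hI, hE⟩ => Set.eq_empty_of_forall_notMem fun y hy => ?_, ?_⟩
    · exact hE {y} ⟨Set.singleton_subset_iff.2 (hI hy), by simp,
        ((H.mem_link_vertexSet_iff x y).1 (hI hy)).2⟩ (Set.singleton_subset_iff.2 hy)
    · rintro rfl
      refine ⟨Set.empty_subset _, fun e he hsub => ?_⟩
      have hc := (H.link x).encard_edge e he
      rw [Set.subset_empty_iff.1 hsub] at hc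
      simp at hc
  change (H.link x).independentSetPolytope = {0}
  unfold independentSetPolytope
  rw [← convexHull_singleton (𝕜 := ℝ) (0 : (H.link x).vertexSet → ℝ)]
  congr 1
  ext f
  simp only [h, Set.mem_ofPred_eq, exists_eq_left, Set.indicator_empty, Set.mem_singleton_iff]
  rfl

/-- For a graph, the theta body is the Lovász theta body. -/
theorem mem_thetaBody_two (H : UniformHypergraph α 2) [Finite H.vertexSet]
    (f : H.vertexSet → ℝ) :
    f ∈ thetaBody 2 H ↔ ∃ F : Matrix H.vertexSet H.vertexSet ℝ, f = F.diag ∧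
      (∀ x y : H.vertexSet, x ≠ y → {(x : α), (y : α)} ∈ H.edgeSet → F x y = 0) ∧
      (F - Matrix.vecMulVec F.diag F.diag).PosSemidef := by
  change (∃ F : Matrix H.vertexSet H.vertexSet ℝ, f = F.diag ∧
      (∀ x : H.vertexSet, (H.link x).vertexSet.Nonempty →
        (fun y : (H.link x).vertexSet => F x ⟨y, H.link_vertexSet_subset x y.2⟩) ∈
          F x x • thetaBody 1 (H.link x)) ∧ (borderedMatrix F).PosSemidef) ↔ _
  refine exists_congr fun F => and_congr_right fun _ => and_congr ?_
    (borderedMatrix_posSemidef_iff F)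
  -- Scaling `{0}` by `F x x` gives `{0}`, so row `x` must vanish on the neighbors of `x`; without
  -- neighbors there is no condition.
  simp only [thetaBody_link_eq_zero, Set.smul_set_singleton, smul_zero, Set.mem_singleton_iff]
  constructor
  · intro h x y hxy he
    have hy : (y : α) ∈ (H.link x).vertexSet :=
      (H.mem_link_vertexSet_iff x y).2 ⟨fun h => hxy (Subtype.ext h.symm), he⟩
    exact congrFun (h x ⟨y, hy⟩) ⟨y, hy⟩
  · intro h x _
    funext y
    obtain ⟨hyx, he⟩ := (H.mem_link_vertexSet_iff x y).1 y.2
    exact h x ⟨y, _⟩ (fun h => hyx (congrArg Subtype.val h).symm) he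

/-- The separate `S` allows passing to matrices indexed by `weightWords n s` without rewriting in
dependent types. -/
theorem mem_thetaValues_one (H : UniformHypergraph α 2) {S : Set α} (hS : H.vertexSet = S)
    [Fintype S] (v : ℝ) :
    v ∈ H.thetaValues 1 ↔ ∃ F : Matrix S S ℝ,
      (F - Matrix.vecMulVec F.diag F.diag).PosSemidef ∧
      (∀ x y : S, x ≠ y → {(x : α), (y : α)} ∈ H.edgeSet → F x y = 0) ∧ v = F.trace := by
  subst hS
  constructor
  · rintro ⟨f, hf, rfl⟩
    obtain ⟨F, rfl, h1, h2⟩ := (H.mem_thetaBody_two f).1 hf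
    exact ⟨F, h2, h1, by simp [finsum_eq_sum_of_fintype, Matrix.trace]⟩
  · rintro ⟨F, h2, h1, rfl⟩
    exact ⟨F.diag, (H.mem_thetaBody_two _).2 ⟨F, rfl, h1, h2⟩,
      by simp [finsum_eq_sum_of_fintype, Matrix.trace]⟩

end UniformHypergraph

/-! ### The link of the zero word. -/

section Link

variable {n s : ℕ}

theorem mem_triangle_edgeSet_iff (x y : HammingCube n) :
    insert 0 {x, y} ∈ (triangleHypergraph n s).edgeSet ∧ x ≠ y ∧ x ≠ 0 ∧ y ≠ 0 ↔
      x ≠ y ∧ x ≠ 0 ∧ y ≠ 0 ∧ x ∈ weightWords n s ∧ y ∈ weightWords n s ∧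
        hammingDist x y = s := by
  constructor
  · rintro ⟨⟨-, h⟩, hxy, hx, hy⟩
    refine ⟨hxy, hx, hy, ?_, ?_, h x (by simp) y (by simp) hxy⟩
    · exact (hammingDist_zero_right x).symm.trans (h x (by simp) 0 (by simp) hx)
    · exact (hammingDist_zero_right y).symm.trans (h y (by simp) 0 (by simp) hy)
  · rintro ⟨hxy, hx, hy, hxs, hys, hd⟩
    refine ⟨⟨?_, ?_⟩, hxy, hx, hy⟩
    · exact Set.encard_eq_three.2 ⟨0, x, y, hx.symm, hy.symm, hxy, rfl⟩
    · have hxs' : hammingNorm x = s := hxs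
      have hys' : hammingNorm y = s := hys
      rintro a ha b hb hab
      simp only [Set.mem_insert_iff, Set.mem_singleton_iff] at ha hb
      rcases ha with rfl | rfl | rfl <;> rcases hb with rfl | rfl | rfl <;>
        simp_all [hammingDist_comm]

theorem ne_zero_of_mem_weightWords (hs0 : 0 < s) {x : HammingCube n} (hx : x ∈ weightWords n s) :
    x ≠ 0 := by
  rintro rfl
  have : hammingNorm (0 : HammingCube n) = s := hx
  rw [hammingNorm_zero] at this
  omega

/-- The bound on `s / 2` gives every word of weight `s` a partner at distance `s`, so each lies in a
triangle with `0`. -/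
theorem link_triangle_vertexSet (hs : Even s) (hs0 : 0 < s) (hsn : s / 2 ≤ min s (n - s)) :
    ((triangleHypergraph n s).link 0).vertexSet = weightWords n s := by
  ext x
  constructor
  · rintro ⟨hx, e, he, h0, hxe⟩
    have := he.2 x hxe 0 h0 hx
    rw [hammingDist_zero_right] at this
    exact this
  · intro hx
    obtain ⟨y, hy, hxy⟩ := exists_excess_eq hx hsn
    have hd : hammingDist x y = s := by
      rw [hammingDist_eq_two_mul_excess hx hy, hxy]
      exact Nat.two_mul_div_two_of_even hs
    have hne : x ≠ y := by
      rintro rfl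
      rw [hammingDist_self] at hd
      omega
    have hx0 := ne_zero_of_mem_weightWords hs0 hx
    exact ⟨hx0, _, ((mem_triangle_edgeSet_iff x y).2
      ⟨hne, hx0, ne_zero_of_mem_weightWords hs0 hy, hx, hy, hd⟩).1, by simp, by simp⟩

theorem link_triangle_edgeSet (hs : Even s) (hs0 : 0 < s) (hsn : s / 2 ≤ min s (n - s)) :
    ((triangleHypergraph n s).link 0).edgeSet =
      {e | ∃ x ∈ weightWords n s, ∃ y ∈ weightWords n s, hammingDist x y = s ∧ e = {x, y}} := by
  have hV := link_triangle_vertexSet hs hs0 hsn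
  ext e
  constructor
  · rintro ⟨hsub, hc, he⟩
    obtain ⟨x, y, hxy, rfl⟩ := Set.encard_eq_two.1 hc
    have hx0 : x ≠ 0 := (hsub (by simp : x ∈ ({x, y} : Set _))).1
    have hy0 : y ≠ 0 := (hsub (by simp : y ∈ ({x, y} : Set _))).1
    obtain ⟨-, -, -, hx, hy, hd⟩ := (mem_triangle_edgeSet_iff x y).1 ⟨he, hxy, hx0, hy0⟩
    exact ⟨x, hx, y, hy, hd, rfl⟩
  · rintro ⟨x, hx, y, hy, hd, rfl⟩
    have hne : x ≠ y := by
      rintro rfl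
      rw [hammingDist_self] at hd
      omega
    refine ⟨?_, Set.encard_pair hne, ((mem_triangle_edgeSet_iff x y).2
      ⟨hne, ne_zero_of_mem_weightWords hs0 hx, ne_zero_of_mem_weightWords hs0 hy, hx, hy, hd⟩).1⟩
    change ({x, y} : Set _) ⊆ ((triangleHypergraph n s).link 0).vertexSet
    rw [hV]
    exact Set.insert_subset hx (Set.singleton_subset_iff.2 hy)

/-- The edges of the link of the zero word, in terms of the excess. -/
theorem pair_mem_link_edgeSet_iff (hs : Even s) (hs0 : 0 < s) (hsn : s / 2 ≤ min s (n - s))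
    (x y : weightWords n s) :
    {(x : HammingCube n), (y : HammingCube n)} ∈ ((triangleHypergraph n s).link 0).edgeSet ↔
      excess (x : HammingCube n) y = s / 2 := by
  have hd2 := hammingDist_eq_two_mul_excess x.2 y.2
  have hs2 := Nat.two_mul_div_two_of_even hs
  rw [link_triangle_edgeSet hs hs0 hsn]
  constructor
  · rintro ⟨a, ha, b, hb, hd, he⟩
    have : hammingDist (x : HammingCube n) y = s := by
      rcases Set.pair_eq_pair_iff.1 he with ⟨h1, h2⟩ | ⟨h1, h2⟩
      · rw [h1, h2, hd]
      · rw [h1, h2, hammingDist_comm, hd]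
    omega
  · intro h
    exact ⟨x, x.2, y, y.2, by omega, rfl⟩

end Link
end

theorem theorem6p2 (n s : ℕ) (hn : 1 ≤ n) (hs : Even s) (hs0 : 0 < s) (hsn : s ≤ 2 * n / 3) :
    -- the link of `0` is the graph on the words of weight `s`, adjacent at distance `s`
    ((triangleHypergraph n s).link 0).vertexSet = weightWords n s ∧
    ((triangleHypergraph n s).link 0).edgeSet =
      {e | ∃ x ∈ weightWords n s, ∃ y ∈ weightWords n s, hammingDist x y = s ∧ e = {x, y}} ∧
    -- the maximum that defines the theta number of the link is attained
    IsGreatest (((triangleHypergraph n s).link 0).thetaValues 1)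
      ((triangleHypergraph n s).link 0).thetaNumber ∧
    -- and its value is
    ((triangleHypergraph n s).link 0).thetaNumber =
      ((weightWords n s).ncard : ℝ) * (hahnMin n s / (hahnMin n s - 1)) := by
  -- This is where `s ≤ 2 * n / 3` enters: it yields `3s ≤ 2n`, hence `s / 2 ≤ n - s`.
  have ht : s / 2 ≤ min s (n - s) := by omega
  have hs2 : 0 < s / 2 := by
    obtain ⟨m, rfl⟩ := hs
    omega
  have hV := link_triangle_vertexSet hs hs0 ht
  have hle : ∀ k ≤ min s (n - s), hahnMin n s ≤ hahnQ n s k (s / 2) := fun k hk =>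
    Finset.inf'_le _ (Finset.mem_range.2 (Nat.lt_succ_of_le hk))
  obtain ⟨k, hk, hkmin⟩ := Finset.exists_mem_eq_inf' Finset.nonempty_range_add_one
    fun k => hahnQ n s k (s / 2)
  replace hkmin : hahnMin n s = hahnQ n s k (s / 2) := hkmin
  have hneg : hahnMin n s < 0 := by
    obtain ⟨j, hj, hjneg⟩ := exists_hahnQ_neg (by omega) ht hs2
    exact (hle j hj).trans_lt hjneg
  have hmax : IsGreatest (((triangleHypergraph n s).link 0).thetaValues 1)
      (((weightWords n s).ncard : ℝ) * (hahnMin n s / (hahnMin n s - 1))) := by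
    constructor
    · obtain ⟨F, h1, h2, h3⟩ := exists_feasible (t₀ := s / 2)
        (Nat.le_of_lt_succ (Finset.mem_range.1 hk)) (hkmin ▸ hneg)
      refine (UniformHypergraph.mem_thetaValues_one _ hV _).2 ⟨F, h1, fun x y _ he => ?_, ?_⟩
      · exact h2 x y ((pair_mem_link_edgeSet_iff hs hs0 ht x y).1 he)
      · rw [h3, hkmin]
    · intro v hv
      obtain ⟨F, h1, h2, rfl⟩ := (UniformHypergraph.mem_thetaValues_one _ hV _).1 hv
      refine trace_le_of_feasible (by omega) ht hneg hle h1 fun x y hxy => ?_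
      refine h2 x y (fun h => ?_) ((pair_mem_link_edgeSet_iff hs hs0 ht x y).2 hxy)
      -- Equal words have excess `0`, but `s / 2 > 0`.
      rw [(excess_eq_zero_iff x.2 y.2).2 (congrArg Subtype.val h)] at hxy
      omega
  have hval : ((triangleHypergraph n s).link 0).thetaNumber =
      ((weightWords n s).ncard : ℝ) * (hahnMin n s / (hahnMin n s - 1)) := hmax.csSup_eq
  exact ⟨hV, link_triangle_edgeSet hs hs0 ht, hval ▸ hmax, hval⟩
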